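/- Let $V$ be a finite-dimensional real vector space with a lattice $M\subset V$ of full rank (so $V=M\otimes_{\mathbb Z}\mathbb R$), let $N=\{\xi\in V^*:\xi(M)\subset\mathbb Z\}$ be the dual lattice, and let $$\bar{\mathcal P}=\{y\in V : d_i(y):=\langle \nu_i,y\rangle+b_i\ge 0 \text{ for all } i\}$$ be a (compact) Delzant polytope, where $b_i\in\mathbb R$ and the finitely many $\nu_i\in N$ are the prime inward normals of the facets, one for each facet; the Delzant condition says that at every vertex the normals of the facets through it form a $\mathbb Z$-basis of $N$. For a face $F$ let $F^\circ$ be its relative interior ($\bar{\mathcal P}$ itself is a face) and $TF\subset V$ its tangent space. A function is called smooth on $\bar{\mathcal P}$ if it is $C^\infty$ up to the boundary. Let $u:\bar{\mathcal P}\to\mathbb R$ be a symplectic potential, that is, a convex function such that * for every face $F$ the restriction $u|_{F^\circ}$ is smooth and strictly convex, in the sense that its Hessian is positive definite on $TF$ at every point of $F^\circ$; * (Guillemin's boundary condition) $u=\sum_i d_i\log d_i+v$ on $\bar{\mathcal P}$ with $v\in C^\infty(\bar{\mathcal P})$ (where $0\log 0=0$). Let $e_1,\dots,e_n$ be any basis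 of $V$ (for example the prime edge vectors at a vertex), with linear coordinates $y^1,\dots,y^n$, and let $u_{ij}=\partial^2u/\partial y^i\partial y^j$ in the interior of $\bar{\mathcal P}$. Then $[u_{ij}]$ is invertible in the interior, and its inverse $[u^{ij}]$ extends to a matrix-valued function on $\bar{\mathcal P}$ with smooth entries. For every face $F$ and every $y\in F^\circ$, the extension satisfies: * the symmetric matrix $[u^{ij}(y)]$ is positive semidefinite; * it is positive definite on the tangent space of the face: $\sum_{i,j}u^{ij}(y)w^iw^j>0$ for every nonzero $w=\sum_i w^ie_i\in TF$; * invariantly, the tensor $\sum_{i,j}u^{ij}(y)\,e_i\otimes e_j$ lies in $TF\otimes TF$ and is positive definite there: for every $\xi\in V^*$ the vector $\sum_{i,j}u^{ij}(y)\xi(e_j)e_i$ lies in $TF$, and $\sum_{i,j}u^{ij}(y)\xi(e_i)\xi(e_j)>0$ whenever $\xi|_{TF}\ne0$. -/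

import Mathlib

open scoped ContDiff

namespace Toric

variable {V : Type*} [NormedAddCommGroup V] [NormedSpace ℝ V]
variable {ι : Type*}

/-- The dual lattice `N = Hom(M, ℤ)` of a lattice `M ⊆ V`, as a subgroup of the dual space. -/
def dualLattice (M : Submodule ℤ V) : Submodule ℤ (V →L[ℝ] ℝ) where
  carrier := {ξ | ∀ m ∈ M, ∃ k : ℤ, ξ m = k}
  add_mem' := by
    intro ξ η hξ hη m hm
    obtain ⟨k, hk⟩ := hξ m hm
    obtain ⟨l, hl⟩ := hη m hm
    exact ⟨k + l, by simp [hk, hl]⟩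
  zero_mem' := fun m _ => ⟨0, by simp⟩
  smul_mem' := by
    intro c ξ hξ m hm
    obtain ⟨k, hk⟩ := hξ m hm
    exact ⟨c * k, by simp [hk]⟩

/-- `ξ` is a prime (primitive) element of the lattice `N`: it is not a proper multiple of
another element of `N` (and it is not zero). -/
def IsPrimeVector (N : Submodule ℤ (V →L[ℝ] ℝ)) (ξ : V →L[ℝ] ℝ) : Prop :=
  ξ ∈ N ∧ ∀ (k : ℕ) (η : V →L[ℝ] ℝ), η ∈ N → ξ = (k : ℝ) • η → k = 1

/-- The defining affine function `d_i(y) = ⟨ν_i, y⟩ + b_i`. -/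
def facetDist (ν : ι → V →L[ℝ] ℝ) (b : ι → ℝ) (i : ι) (y : V) : ℝ := ν i y + b i

/-- The closed polytope `{y | d_i(y) ≥ 0 for all i}`. -/
def polytope (ν : ι → V →L[ℝ] ℝ) (b : ι → ℝ) : Set V := {y | ∀ i, 0 ≤ facetDist ν b i y}

/-- The relative interior of the face cut out by the facets in `I`: the points of the polytope at
which exactly the `d_i` with `i ∈ I` vanish. For `I = ∅` it is the interior of the polytope. The
nonempty sets of this form are the relative interiors of the nonempty faces. -/
def openFace (ν : ι → V →L[ℝ] ℝ) (b : ι → ℝ) (I : Set ι) : Set V :=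
  {y | y ∈ polytope ν b ∧ ∀ i, facetDist ν b i y = 0 ↔ i ∈ I}

/-- The tangent space (direction) of the face with relative interior `openFace ν b I`, provided
that the latter is nonempty. -/
def faceTangent (ν : ι → V →L[ℝ] ℝ) (I : Set ι) : Submodule ℝ V where
  carrier := {w | ∀ i ∈ I, ν i w = 0}
  add_mem' := by
    intro w w' hw hw' i hi
    simp [hw i hi, hw' i hi]
  zero_mem' := fun i _ => by simp
  smul_mem' := by
    intro c w hw i hi
    simp [hw i hi]

/-- `{y | d_i(y) ≥ 0}` is a Delzant polytope with respect to the lattice `M`, and the `ν_i` are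
exactly the prime inward normals of its facets. -/
structure IsDelzant (M : Submodule ℤ V) (ν : ι → V →L[ℝ] ℝ) (b : ι → ℝ) : Prop where
  bounded : Bornology.IsBounded (polytope ν b)
  prime : ∀ i, IsPrimeVector (dualLattice M) (ν i)
  /-- Each `ν_i` is the normal of a facet, and different indices give different facets. -/
  facet : ∀ i, (openFace ν b {i}).Nonempty
  /-- At every vertex the normals of the facets through it form a `ℤ`-basis of the dual lattice
  (they generate it and are linearly independent). -/
  vertex : ∀ q ∈ (polytope ν b).extremePoints ℝ,
    LinearIndependent ℝ (fun i : {i // facetDist ν b i q = 0} => ν i) ∧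
      Submodule.span ℤ (ν '' {i | facetDist ν b i q = 0}) = dualLattice M

/-- `u` is a symplectic potential on the polytope. Smoothness on the closed polytope is
`ContDiffOn ℝ ∞` there; `0 log 0 = 0`. Strict convexity of the restriction to the interior of a
face means that its Hessian is positive definite. -/
structure IsSymplecticPotential [Fintype ι] (ν : ι → V →L[ℝ] ℝ) (b : ι → ℝ) (u : V → ℝ) :
    Prop where
  convex : ConvexOn ℝ (polytope ν b) u
  smooth_face : ∀ I : Set ι, ContDiffOn ℝ ∞ u (openFace ν b I)
  hessian_face : ∀ I : Set ι, ∀ y ∈ openFace ν b I, ∀ w ∈ faceTangent ν I, w ≠ 0 →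
    0 < iteratedDeriv 2 (fun t : ℝ => u (y + t • w)) 0
  guillemin : ∃ v : V → ℝ, ContDiffOn ℝ ∞ v (polytope ν b) ∧
    ∀ y ∈ polytope ν b,
      u y = ∑ i, facetDist ν b i y * Real.log (facetDist ν b i y) + v y

/-- The Hessian matrix `[∂²u/∂y^i∂y^j]` at `y` in the linear coordinates `y^i` given by a basis
`e` of `V` (and any choice of origin). -/
noncomputable def hessian {n : ℕ} (e : Module.Basis (Fin n) ℝ V) (u : V → ℝ) (y : V) :
    Matrix (Fin n) (Fin n) ℝ :=
  fun i j => fderiv ℝ (fun z => fderiv ℝ u z (e j)) y (e i)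

/-- The vector `∑ A^{ij} ξ(e_j) e_i`: the tensor `∑ A^{ij} e_i ⊗ e_j` applied to a covector. -/
noncomputable def contract {n : ℕ} (e : Module.Basis (Fin n) ℝ V) (A : Matrix (Fin n) (Fin n) ℝ)
    (ξ : V →L[ℝ] ℝ) : V :=
  ∑ i, (∑ j, A i j * ξ (e j)) • e i

end Toric

/-! In the interior the Hessian of `u` is `B + ∑ ν_k ⊗ ν_k / d_k` with `B` the Hessian of `v`, so it
blows up at the facets. It is the Schur complement of `bordered`, whose entries stay smooth up to
the boundary; hence `G`, the upper left block of the inverse bordered matrix, is the required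
extension once that matrix is invertible on the whole polytope. At a point `y`, a solution `(x, l)`
of the system with right side `(a, 0)` has `ν_k x = d_k l_k`, so `x` is tangent to the face of `y`,
and `a ⬝ᵥ x` is the Hessian of `u` restricted to that face, evaluated at `x`
(`iteratedDeriv_two_line`). Positivity there and independence of the normals at `y`
(`IsDelzant.linearIndependent`) give invertibility (`isUnit_det_bordered`), tangency of `G` and its
positivity. -/

namespace Toric

open scoped Matrix Topology

variable {V : Type*} [NormedAddCommGroup V] [NormedSpace ℝ V] {ι : Type*}

/-- The bordered matrix `[[B, νᵀ], [ν, -diag d]]`. Eliminating the second block of unknowns turns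
it into the form `B + ∑ ν_k ⊗ ν_k / d_k`, but its entries make sense also where `d_k = 0`. -/
noncomputable def bordered [DecidableEq ι] {n : ℕ} (e : Module.Basis (Fin n) ℝ V)
    (B : V →L[ℝ] V →L[ℝ] ℝ) (ν : ι → V →L[ℝ] ℝ) (d : ι → ℝ) :
    Matrix (Fin n ⊕ ι) (Fin n ⊕ ι) ℝ :=
  Matrix.fromBlocks (Matrix.of fun i j => B (e i) (e j)) (Matrix.of fun i k => ν k (e i))
    (Matrix.of fun k j => ν k (e j)) (-Matrix.diagonal d)

/-! ### Linear algebra of the bordered matrix at one point. -/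

section Algebra

variable [Fintype ι] [DecidableEq ι] {n : ℕ} (e : Module.Basis (Fin n) ℝ V)
  (B : V →L[ℝ] V →L[ℝ] ℝ) (ν : ι → V →L[ℝ] ℝ) (d : ι → ℝ)

lemma bordered_mulVec (x : Fin n → ℝ) (l : ι → ℝ) :
    bordered e B ν d *ᵥ Sum.elim x l =
      Sum.elim (fun i => B (e i) (e.equivFun.symm x) + ∑ k, l k * ν k (e i))
        (fun k => ν k (e.equivFun.symm x) - d k * l k) := by
  rw [bordered, Matrix.fromBlocks_mulVec]
  congr 1
  · funext i
    simp [Matrix.mulVec, dotProduct, Module.Basis.equivFun_symm_apply, mul_comm]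
  · funext k
    simp [Matrix.mulVec, dotProduct, Module.Basis.equivFun_symm_apply, mul_comm,
      Matrix.diagonal_apply, sub_eq_add_neg]

variable {e B ν d}

lemma apply_eq_of_bordered_mulVec_eq {x a : Fin n → ℝ} {l : ι → ℝ}
    (h : bordered e B ν d *ᵥ Sum.elim x l = Sum.elim a 0) (k : ι) :
    ν k (e.equivFun.symm x) = d k * l k := by
  rw [bordered_mulVec] at h
  have := congrFun h (Sum.inr k)
  simpa [sub_eq_zero] using this

lemma dotProduct_eq_of_bordered_mulVec_eq {x a : Fin n → ℝ} {l : ι → ℝ}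
    (h : bordered e B ν d *ᵥ Sum.elim x l = Sum.elim a 0) (w : Fin n → ℝ) :
    a ⬝ᵥ w = B (e.equivFun.symm w) (e.equivFun.symm x)
      + ∑ k, l k * ν k (e.equivFun.symm w) := by
  rw [bordered_mulVec] at h
  have ha : ∀ i, a i = B (e i) (e.equivFun.symm x) + ∑ k, l k * ν k (e i) := fun i => by
    have := congrFun h (Sum.inl i)
    simpa using this.symm
  simp only [dotProduct, ha, Module.Basis.equivFun_symm_apply e w, map_sum, map_smul,
    sum_apply, smul_apply, smul_eq_mul, add_mul,
    Finset.sum_add_distrib, Finset.mul_sum, Finset.sum_mul]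
  congr 1
  · exact Finset.sum_congr rfl fun _ _ => mul_comm _ _
  · rw [Finset.sum_comm]
    exact Finset.sum_congr rfl fun _ _ => Finset.sum_congr rfl fun _ _ => by ring

/-- Since `ν_k x = d_k l_k`, each `l_k ν_k x` equals `(ν_k x)² / d_k`; when `d_k = 0` both are zero,
the quotient by the convention `t / 0 = 0`. -/
lemma dotProduct_self_eq_of_bordered_mulVec_eq {x a : Fin n → ℝ} {l : ι → ℝ}
    (h : bordered e B ν d *ᵥ Sum.elim x l = Sum.elim a 0) :
    a ⬝ᵥ x = B (e.equivFun.symm x) (e.equivFun.symm x)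
      + ∑ k, (ν k (e.equivFun.symm x)) ^ 2 / d k := by
  rw [dotProduct_eq_of_bordered_mulVec_eq h]
  congr 1
  refine Finset.sum_congr rfl fun k _ => ?_
  rw [apply_eq_of_bordered_mulVec_eq h k]
  by_cases hd : d k = 0
  · simp [hd]
  · field_simp

/-- Positivity of `B + ∑ ν_k ⊗ ν_k / d_k` on the common kernel of the `ν_k` with `d_k = 0`. -/
def PosOnFace (B : V →L[ℝ] V →L[ℝ] ℝ) (ν : ι → V →L[ℝ] ℝ) (d : ι → ℝ) : Prop :=
  ∀ w : V, (∀ k, d k = 0 → ν k w = 0) → w ≠ 0 → 0 < B w w + ∑ k, (ν k w) ^ 2 / d k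

/-- The second block of equations makes `x` tangent to the face, where `a ⬝ᵥ x` is a positive
definite form in `x`. Invertibility and both positivity statements come from this. -/
lemma eq_zero_of_bordered_mulVec_eq (hB : PosOnFace B ν d) {x a : Fin n → ℝ} {l : ι → ℝ}
    (h : bordered e B ν d *ᵥ Sum.elim x l = Sum.elim a 0) (ha : a ⬝ᵥ x ≤ 0) :
    x = 0 ∧ ∀ k, d k ≠ 0 → l k = 0 := by
  have hν := apply_eq_of_bordered_mulVec_eq h
  have hx : e.equivFun.symm x = 0 := by
    by_contra hne
    have := hB _ (fun k hk => by rw [hν, hk, zero_mul]) hne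
    rw [← dotProduct_self_eq_of_bordered_mulVec_eq h] at this
    exact this.not_ge ha
  refine ⟨e.equivFun.symm.map_eq_zero_iff.1 hx, fun k hk => ?_⟩
  have := hν k
  rw [hx, map_zero] at this
  exact (mul_eq_zero.1 this.symm).resolve_left hk

/-- A kernel vector has `x = 0` and `l` supported where `d_k = 0`; the first block then reads `∑ l_k
ν_k = 0`, a relation among independent normals. -/
lemma isUnit_det_bordered (hB : PosOnFace B ν d)
    (hν : LinearIndependent ℝ fun k : {k // d k = 0} => ν k) :
    IsUnit (bordered e B ν d).det := by
  rw [isUnit_iff_ne_zero]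
  intro hdet
  obtain ⟨z, hz, h⟩ := Matrix.exists_mulVec_eq_zero_iff.2 hdet
  obtain ⟨x, l, rfl⟩ : ∃ (x : Fin n → ℝ) (l : ι → ℝ), z = Sum.elim x l := ⟨z ∘ Sum.inl, z ∘ Sum.inr, by simp⟩
  have h0 : bordered e B ν d *ᵥ Sum.elim x l =
      Sum.elim (0 : Fin n → ℝ) 0 := by rw [h]; simp
  obtain ⟨rfl, hl⟩ := eq_zero_of_bordered_mulVec_eq hB h0 (by simp)
  have hsum : ∑ k : {k // d k = 0}, l k • ν k = 0 := by
    ext w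
    have := dotProduct_eq_of_bordered_mulVec_eq h0 (e.equivFun w)
    rw [zero_dotProduct, map_zero, map_zero, zero_add, LinearEquiv.symm_apply_apply] at this
    rw [Finset.sum_subtype (Finset.univ.filter fun k => d k = 0) (p := fun k => d k = 0)
      (by simp) (fun k => l k • ν k) |>.symm, Finset.sum_filter_of_ne]
    · simpa using this.symm
    · intro k _ hk
      by_contra hd
      exact hk (by rw [hl k hd, zero_smul])
  have hl' := Fintype.linearIndependent_iff.1 hν (fun k => l k) hsum
  apply hz
  have : l = 0 := by
    funext k
    by_cases hk : d k = 0
    · exact hl' ⟨k, hk⟩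
    · exact hl k hk
  simp [this]

lemma bordered_mulVec_inv (hK : IsUnit (bordered e B ν d).det) (a : Fin n → ℝ) :
    ∃ l : ι → ℝ, bordered e B ν d *ᵥ
      Sum.elim ((bordered e B ν d)⁻¹.toBlocks₁₁ *ᵥ a) l = Sum.elim a 0 := by
  set K := bordered e B ν d
  refine ⟨K⁻¹.toBlocks₂₁ *ᵥ a, ?_⟩
  have : K⁻¹ *ᵥ Sum.elim a 0 = Sum.elim (K⁻¹.toBlocks₁₁ *ᵥ a) (K⁻¹.toBlocks₂₁ *ᵥ a) := by
    conv_lhs => rw [← Matrix.fromBlocks_toBlocks K⁻¹, Matrix.fromBlocks_mulVec]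
    simp
  rw [← this, Matrix.mulVec_mulVec, Matrix.mul_nonsing_inv _ hK, Matrix.one_mulVec]

lemma apply_inv_bordered (hK : IsUnit (bordered e B ν d).det) (a : Fin n → ℝ) {k : ι}
    (hk : d k = 0) :
    ν k (e.equivFun.symm ((bordered e B ν d)⁻¹.toBlocks₁₁ *ᵥ a)) = 0 := by
  obtain ⟨l, hl⟩ := bordered_mulVec_inv hK a
  rw [apply_eq_of_bordered_mulVec_eq hl k, hk, zero_mul]

/-- If the value were not positive, `a` would be a combination of the `ν_k` with `d_k = 0` and would
vanish on tangent vectors such as `w`. -/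
lemma dotProduct_inv_bordered_pos (hB : PosOnFace B ν d) (hK : IsUnit (bordered e B ν d).det)
    {a : Fin n → ℝ} {w : V} (hw : ∀ k, d k = 0 → ν k w = 0) (ha : a ⬝ᵥ e.equivFun w ≠ 0) :
    0 < a ⬝ᵥ (bordered e B ν d)⁻¹.toBlocks₁₁ *ᵥ a := by
  obtain ⟨l, hl⟩ := bordered_mulVec_inv hK a
  by_contra! hle
  obtain ⟨hx, hl0⟩ := eq_zero_of_bordered_mulVec_eq hB hl hle
  apply ha
  rw [dotProduct_eq_of_bordered_mulVec_eq hl, hx]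
  simp only [map_zero, zero_add, LinearEquiv.symm_apply_apply]
  refine Finset.sum_eq_zero fun k _ => ?_
  by_cases hk : d k = 0
  · rw [hw k hk, mul_zero]
  · rw [hl0 k hk, zero_mul]

lemma dotProduct_inv_bordered_nonneg (hB : PosOnFace B ν d)
    (hK : IsUnit (bordered e B ν d).det) (a : Fin n → ℝ) :
    0 ≤ a ⬝ᵥ (bordered e B ν d)⁻¹.toBlocks₁₁ *ᵥ a := by
  obtain ⟨l, hl⟩ := bordered_mulVec_inv hK a
  by_contra! hlt
  obtain ⟨hx, -⟩ := eq_zero_of_bordered_mulVec_eq hB hl hlt.le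
  rw [hx, dotProduct_zero] at hlt
  exact hlt.false

lemma posSemidef_inv_bordered (hsymm : ∀ w w', B w w' = B w' w) (hB : PosOnFace B ν d)
    (hK : IsUnit (bordered e B ν d).det) :
    (bordered e B ν d)⁻¹.toBlocks₁₁.PosSemidef := by
  have hKs : (bordered e B ν d).IsSymm := by
    rw [bordered]
    refine Matrix.IsSymm.fromBlocks ?_ ?_ ?_
    · ext i j; exact hsymm _ _
    · ext i j; rfl
    · simp [Matrix.IsSymm]
  refine Matrix.PosSemidef.of_dotProduct_mulVec_nonneg ?_ fun a => ?_
  · ext i j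
    have : (bordered e B ν d)⁻¹.IsSymm := by
      rw [Matrix.IsSymm, Matrix.transpose_nonsing_inv, hKs]
    simpa [Matrix.toBlocks₁₁] using this.apply (Sum.inl i) (Sum.inl j)
  · simpa using dotProduct_inv_bordered_nonneg hB hK a

/-- Schur complement: substitute `l_k = ν_k x / d_k` into the first block. -/
lemma mul_inv_bordered (hd : ∀ k, d k ≠ 0) (hK : IsUnit (bordered e B ν d).det) :
    (Matrix.of fun i j => B (e i) (e j) + ∑ k, ν k (e i) * ν k (e j) / d k) *
      (bordered e B ν d)⁻¹.toBlocks₁₁ = 1 := by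
  refine Matrix.ext_of_mulVec_single fun j => ?_
  obtain ⟨l, hl⟩ := bordered_mulVec_inv hK (Pi.single j 1)
  rw [← Matrix.mulVec_mulVec, Matrix.one_mulVec]
  set x := (bordered e B ν d)⁻¹.toBlocks₁₁ *ᵥ Pi.single j 1
  funext i
  have h1 := dotProduct_eq_of_bordered_mulVec_eq hl (Pi.single i 1)
  have h2 := apply_eq_of_bordered_mulVec_eq hl
  have hl' : ∀ k, l k = ν k (e.equivFun.symm x) / d k := fun k => by
    rw [h2, mul_div_cancel_left₀ _ (hd k)]
  have he : e.equivFun.symm (Pi.single i 1) = e i := by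
    simp [Module.Basis.equivFun_symm_apply, Pi.single_apply]
  simp only [dotProduct_single, mul_one, he] at h1
  rw [h1]
  simp only [hl', Matrix.mulVec, dotProduct, Matrix.of_apply, add_mul, Finset.sum_add_distrib,
    Module.Basis.equivFun_symm_apply, map_sum, map_smul, smul_eq_mul, Finset.sum_mul,
    Finset.sum_div]
  congr 1
  · exact Finset.sum_congr rfl fun _ _ => mul_comm _ _
  · rw [Finset.sum_comm]
    exact Finset.sum_congr rfl fun _ _ => Finset.sum_congr rfl fun _ _ => by ring

end Algebra

/-! ### Convex geometry of the Delzant polytope. -/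

section Polytope

variable {ν : ι → V →L[ℝ] ℝ} {b : ι → ℝ}

lemma facetDist_add_smul (i : ι) (y w : V) (t : ℝ) :
    facetDist ν b i (y + t • w) = facetDist ν b i y + t * ν i w := by
  simp [facetDist]; ring

lemma hasFDerivAt_facetDist (i : ι) (y : V) : HasFDerivAt (facetDist ν b i) (ν i) y :=
  (ν i).hasFDerivAt.add_const _

lemma contDiff_facetDist (i : ι) : ContDiff ℝ ∞ (facetDist ν b i) :=
  (ν i).contDiff.add contDiff_const

lemma continuous_facetDist (i : ι) : Continuous (facetDist ν b i) :=
  (contDiff_facetDist i).continuous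

lemma convex_polytope : Convex ℝ (polytope ν b) := by
  intro x hx y hy s t hs ht hst i
  have h : facetDist ν b i (s • x + t • y) = s * facetDist ν b i x + t * facetDist ν b i y := by
    simp only [facetDist, map_add, map_smul, smul_eq_mul]
    linear_combination - b i * hst
  rw [h]
  exact add_nonneg (mul_nonneg hs (hx i)) (mul_nonneg ht (hy i))

lemma isClosed_polytope : IsClosed (polytope ν b) := by
  simp only [polytope, Set.ofPred_forall]
  exact isClosed_iInter fun i => isClosed_le continuous_const (continuous_facetDist i)

lemma mem_interior_polytope [Finite ι] {y : V} (hy : ∀ i, 0 < facetDist ν b i y) :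
    y ∈ interior (polytope ν b) := by
  have h : ∀ᶠ z in 𝓝 y, ∀ i, 0 < facetDist ν b i z :=
    Filter.eventually_all.2 fun i => (continuous_facetDist i).continuousAt.eventually_const_lt (hy i)
  exact mem_interior_iff_mem_nhds.2 (h.mono fun z hz i => (hz i).le)

lemma facetDist_pos_of_mem_interior {i : ι} (hi : ν i ≠ 0) {y : V}
    (hy : y ∈ interior (polytope ν b)) : 0 < facetDist ν b i y := by
  refine (interior_subset hy i).lt_of_ne fun h0 => hi ?_
  have hmin : IsLocalMin (facetDist ν b i) y := by
    filter_upwards [mem_interior_iff_mem_nhds.1 hy] with z hz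
    rw [← h0]
    exact hz i
  exact hmin.hasFDerivAt_eq_zero (hasFDerivAt_facetDist i y)

lemma eventually_mem_polytope_of_tangent [Finite ι] {y w : V} (hy : y ∈ polytope ν b)
    (hw : ∀ i, facetDist ν b i y = 0 → ν i w = 0) :
    ∀ᶠ t : ℝ in 𝓝 0, y + t • w ∈ polytope ν b := by
  refine Filter.eventually_all.2 fun i => ?_
  rcases (hy i).eq_or_lt with h | h
  · refine .of_forall fun t => ?_
    rw [facetDist_add_smul, ← h, hw i h.symm]
    simp
  · have hc : ContinuousAt (fun t : ℝ => facetDist ν b i (y + t • w)) 0 :=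
      ((continuous_facetDist i).comp (by fun_prop)).continuousAt
    exact (hc.eventually_const_lt (u := 0) (by simpa using h)).mono fun t ht => ht.le

lemma IsPrimeVector.ne_zero {N : Submodule ℤ (V →L[ℝ] ℝ)} {ξ : V →L[ℝ] ℝ}
    (h : IsPrimeVector N ξ) : ξ ≠ 0 := by
  rintro rfl
  have := h.2 2 0 N.zero_mem (by simp)
  omega

variable {M : Submodule ℤ V}

/-- A relative interior point of a facet, pushed slightly inward, makes every `d_j` positive. -/
lemma IsDelzant.interior_nonempty [Finite ι] (hP : IsDelzant M ν b) :
    (interior (polytope ν b)).Nonempty := by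
  rcases isEmpty_or_nonempty ι with _ | ⟨⟨i⟩⟩
  · exact ⟨0, mem_interior_polytope fun i => isEmptyElim i⟩
  obtain ⟨y, hy, hyi⟩ := hP.facet i
  obtain ⟨w, hw⟩ : ∃ w, 0 < ν i w := by
    obtain ⟨w, hw⟩ := DFunLike.ne_iff.1 (hP.prime i).ne_zero
    rcases lt_or_gt_of_ne hw with h | h
    · exact ⟨-w, by simpa using h⟩
    · exact ⟨w, h⟩
  have key : ∀ᶠ t : ℝ in 𝓝[>] 0, ∀ j, 0 < facetDist ν b j (y + t • w) := by
    refine Filter.eventually_all.2 fun j => ?_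
    by_cases hj : j = i
    · subst hj
      filter_upwards [self_mem_nhdsWithin] with t ht
      rw [facetDist_add_smul, (hyi j).2 rfl, zero_add]
      exact mul_pos ht hw
    · have hpos : 0 < facetDist ν b j y := (hy j).lt_of_ne fun h => hj ((hyi j).1 h.symm)
      have hc : ContinuousAt (fun t : ℝ => facetDist ν b j (y + t • w)) 0 :=
        ((continuous_facetDist j).comp (by fun_prop)).continuousAt
      exact nhdsWithin_le_nhds (hc.eventually_const_lt (u := 0) (by simpa using hpos))
  obtain ⟨t, ht⟩ := key.exists
  exact ⟨_, mem_interior_polytope ht⟩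

lemma IsDelzant.uniqueDiffOn [Finite ι] (hP : IsDelzant M ν b) :
    UniqueDiffOn ℝ (polytope ν b) :=
  uniqueDiffOn_convex convex_polytope hP.interior_nonempty

/-- The closed face through `y` has a vertex, at which the normals are independent. -/
lemma IsDelzant.linearIndependent [FiniteDimensional ℝ V] (hP : IsDelzant M ν b) {y : V}
    (hy : y ∈ polytope ν b) :
    LinearIndependent ℝ fun i : {i // facetDist ν b i y = 0} => ν i := by
  set F : Set V := {z | z ∈ polytope ν b ∧ ∀ i, facetDist ν b i y = 0 → facetDist ν b i z = 0}
  have hFP : F ⊆ polytope ν b := fun z hz => hz.1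
  have hFclosed : IsClosed F := by
    have h : IsClosed {z | ∀ i, facetDist ν b i y = 0 → facetDist ν b i z = 0} := by
      simp only [Set.ofPred_forall]
      exact isClosed_iInter fun i => isClosed_iInter fun _ =>
        isClosed_eq (continuous_facetDist i) continuous_const
    exact isClosed_polytope.inter h
  -- Extremality of `F` makes its extreme points vertices of the polytope, where the Delzant
  -- condition applies.
  have hext : IsExtreme ℝ (polytope ν b) F := by
    refine ⟨hFP, fun x hx z hz p hp hxz => ⟨hx, fun i hi => ?_⟩⟩
    obtain ⟨s, t, hs, ht, hst, rfl⟩ := hxz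
    have h : facetDist ν b i (s • x + t • z) =
        s * facetDist ν b i x + t * facetDist ν b i z := by
      simp only [facetDist, map_add, map_smul, smul_eq_mul]
      linear_combination - b i * hst
    rw [hp.2 i hi] at h
    have h1 := mul_nonneg hs.le (hx i)
    have h2 := mul_nonneg ht.le (hz i)
    have h3 : s * facetDist ν b i x = 0 := by linarith
    exact (mul_eq_zero.1 h3).resolve_left hs.ne'
  have : ProperSpace V := FiniteDimensional.proper ℝ V
  obtain ⟨q, hq⟩ := (Metric.isCompact_of_isClosed_isBounded hFclosed
    (hP.bounded.subset hFP)).extremePoints_nonempty ⟨y, hy, fun _ h => h⟩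
  have hli := (hP.vertex q (hext.extremePoints_subset_extremePoints hq)).1
  exact hli.comp (fun i : {i // facetDist ν b i y = 0} =>
    (⟨i, hq.1.2 i i.2⟩ : {i // facetDist ν b i q = 0}))
    fun i j h => by simpa [Subtype.ext_iff] using h

end Polytope

/-! ### Smoothness of the matrix inverse, by Cramer's rule. -/

section Smooth

variable {E : Type*} [NormedAddCommGroup E] [NormedSpace ℝ E] {m : Type*} [Fintype m]
  [DecidableEq m] {A : E → Matrix m m ℝ} {s : Set E}

lemma contDiffOn_det (hA : ∀ i j, ContDiffOn ℝ ∞ (fun y => A y i j) s) :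
    ContDiffOn ℝ ∞ (fun y => (A y).det) s := by
  simp only [Matrix.det_apply]
  exact ContDiffOn.sum fun σ _ => (contDiffOn_prod fun i _ => hA _ _).const_smul _

lemma contDiffOn_matrix_inv (hA : ∀ i j, ContDiffOn ℝ ∞ (fun y => A y i j) s)
    (hdet : ∀ y ∈ s, IsUnit (A y).det) (i j : m) :
    ContDiffOn ℝ ∞ (fun y => (A y)⁻¹ i j) s := by
  simp only [Matrix.inv_def, Ring.inverse_eq_inv', Matrix.smul_apply, smul_eq_mul,
    Matrix.adjugate_apply]
  refine ((contDiffOn_det hA).inv fun y hy => (hdet y hy).ne_zero).mul (contDiffOn_det ?_)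
  intro k l
  simp only [Matrix.updateRow_apply]
  split_ifs
  · exact contDiffOn_const
  · exact hA k l

end Smooth

/-! ### Second derivatives of `u` under Guillemin's boundary condition. -/

section Hessian

variable {ν : ι → V →L[ℝ] ℝ} {b : ι → ℝ} {u v : V → ℝ}

/-- The second derivative of `v`, up to the boundary of `s`. -/
noncomputable def hessWithin (v : V → ℝ) (s : Set V) (y : V) : V →L[ℝ] V →L[ℝ] ℝ :=
  fderivWithin ℝ (fderivWithin ℝ v s) s y

lemma contDiffOn_hessWithin {s : Set V} (hs : UniqueDiffOn ℝ s) (hv : ContDiffOn ℝ ∞ v s) :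
    ContDiffOn ℝ ∞ (hessWithin v s) s :=
  (hv.fderivWithin hs (m := ∞) (by simp)).fderivWithin hs (by simp)

lemma hasFDerivWithinAt_fderivWithin {s : Set V} (hs : UniqueDiffOn ℝ s)
    (hv : ContDiffOn ℝ ∞ v s) {y : V} (hy : y ∈ s) :
    HasFDerivWithinAt (fderivWithin ℝ v s) (hessWithin v s y) s y :=
  ((hv.fderivWithin hs (m := ∞) (by simp)).differentiableOn (by simp) y hy).hasFDerivWithinAt

/-- Symmetry holds up to the boundary because a convex set with nonempty interior lies in the
closure of that interior. -/
lemma hessWithin_comm (hi : (interior (polytope ν b)).Nonempty)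
    (hv : ContDiffOn ℝ ∞ v (polytope ν b)) {y : V} (hy : y ∈ polytope ν b) (w w' : V) :
    hessWithin v (polytope ν b) y w w' = hessWithin v (polytope ν b) y w' w := by
  refine ((contDiffWithinAt_infty.1 (hv y hy) 2).isSymmSndFDerivWithinAt (by simp) (uniqueDiffOn_convex convex_polytope hi)
    ?_ hy) w w'
  rw [convex_polytope.closure_interior_eq_closure_of_nonempty_interior hi]
  exact subset_closure hy

lemma hasDerivAt_line (y w : V) (t : ℝ) : HasDerivAt (fun t : ℝ => y + t • w) w t := by
  simpa using ((hasDerivAt_id t).smul_const w).const_add y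

variable [Fintype ι]

/-- Along a line tangent to the face, the singular terms with `d_i y = 0` are identically `0 log 0 =
0`; every other `d log d` is smooth near `y`, with second derivative `(ν_i w)² / d_i`. -/
lemma iteratedDeriv_two_line (hs : UniqueDiffOn ℝ (polytope ν b))
    (hv : ContDiffOn ℝ ∞ v (polytope ν b))
    (hu : ∀ y ∈ polytope ν b,
      u y = ∑ i, facetDist ν b i y * Real.log (facetDist ν b i y) + v y)
    {y w : V} (hy : y ∈ polytope ν b) (hw : ∀ i, facetDist ν b i y = 0 → ν i w = 0) :
    iteratedDeriv 2 (fun t : ℝ => u (y + t • w)) 0 =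
      hessWithin v (polytope ν b) y w w + ∑ i, (ν i w) ^ 2 / facetDist ν b i y := by
  set P := polytope ν b
  have hmem : ∀ᶠ t : ℝ in 𝓝 0, y + t • w ∈ P := eventually_mem_polytope_of_tangent hy hw
  have hne : ∀ᶠ t : ℝ in 𝓝 0, ∀ i, facetDist ν b i y ≠ 0 → facetDist ν b i (y + t • w) ≠ 0 := by
    refine Filter.eventually_all.2 fun i => ?_
    by_cases hi : facetDist ν b i y = 0
    · simp [hi]
    have hc : ContinuousAt (fun t : ℝ => facetDist ν b i (y + t • w)) 0 :=
      ((continuous_facetDist i).comp (by fun_prop)).continuousAt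
    exact (hc.eventually_ne (by simpa using hi)).mono fun t ht _ => ht
  have hd : ∀ i t, HasDerivAt (fun t : ℝ => facetDist ν b i (y + t • w)) (ν i w) t :=
    fun i t => (hasFDerivAt_facetDist i _).comp_hasDerivAt t (hasDerivAt_line y w t)
  have h1 : deriv (fun t : ℝ => u (y + t • w)) =ᶠ[𝓝 0] fun t =>
      ∑ i, (Real.log (facetDist ν b i (y + t • w)) + 1) * ν i w
        + fderivWithin ℝ v P (y + t • w) w := by
    filter_upwards [eventually_eventually_nhds.2 hmem, hne] with t ht hnet
    have hvd : HasDerivAt (fun t : ℝ => v (y + t • w)) (fderivWithin ℝ v P (y + t • w) w) t :=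
      (hv.differentiableOn (by simp) _ ht.self_of_nhds).hasFDerivWithinAt.comp_hasDerivAt t
        (hasDerivAt_line y w t) ht
    have hsum : HasDerivAt (fun t : ℝ => ∑ i, facetDist ν b i (y + t • w) *
        Real.log (facetDist ν b i (y + t • w)))
        (∑ i, (Real.log (facetDist ν b i (y + t • w)) + 1) * ν i w) t := by
      refine HasDerivAt.fun_sum fun i _ => ?_
      by_cases hi : facetDist ν b i y = 0
      · simpa [facetDist_add_smul, hi, hw i hi] using hasDerivAt_const t (0 : ℝ)
      · exact (Real.hasDerivAt_mul_log (hnet i hi)).comp t (hd i t)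
    refine HasDerivAt.deriv ((hsum.add hvd).congr_of_eventuallyEq ?_)
    filter_upwards [ht] with r hr using hu _ hr
  rw [iteratedDeriv_succ, iteratedDeriv_one, h1.deriv_eq]
  have hvd : HasDerivAt (fun t : ℝ => fderivWithin ℝ v P (y + t • w) w)
      (hessWithin v P y w w) 0 := by
    have h0 : HasFDerivWithinAt (fderivWithin ℝ v P) (hessWithin v P y) P (y + (0 : ℝ) • w) := by
      simpa using hasFDerivWithinAt_fderivWithin hs hv hy
    have := h0.comp_hasDerivAt (0 : ℝ) (hasDerivAt_line y w 0) hmem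
    simpa using this.clm_apply (hasDerivAt_const (0 : ℝ) w)
  have hsum : HasDerivAt (fun t : ℝ => ∑ i, (Real.log (facetDist ν b i (y + t • w)) + 1) * ν i w)
      (∑ i, (ν i w) ^ 2 / facetDist ν b i y) 0 := by
    refine HasDerivAt.fun_sum fun i _ => ?_
    by_cases hi : facetDist ν b i y = 0
    · simpa [hw i hi] using hasDerivAt_const (0 : ℝ) (0 : ℝ)
    · have := (((hd i 0).log (by simpa using hi)).add_const 1).mul_const (ν i w)
      refine this.congr_deriv ?_
      rw [zero_smul, add_zero]
      ring
  rw [(hsum.fun_add hvd).deriv, add_comm]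

lemma hessian_eq_of_mem_interior (hs : UniqueDiffOn ℝ (polytope ν b))
    (hv : ContDiffOn ℝ ∞ v (polytope ν b)) (hν : ∀ i, ν i ≠ 0)
    (hu : ∀ y ∈ polytope ν b,
      u y = ∑ i, facetDist ν b i y * Real.log (facetDist ν b i y) + v y)
    {n : ℕ} (e : Module.Basis (Fin n) ℝ V) {y : V} (hy : y ∈ interior (polytope ν b)) :
    hessian e u y = Matrix.of fun i j => hessWithin v (polytope ν b) y (e i) (e j)
      + ∑ k, ν k (e i) * ν k (e j) / facetDist ν b k y := by
  set P := polytope ν b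
  have hpos : ∀ z ∈ interior P, ∀ k, facetDist ν b k z ≠ 0 := fun z hz k =>
    (facetDist_pos_of_mem_interior (hν k) hz).ne'
  have h1 : ∀ z ∈ interior P, fderiv ℝ u z =
      ∑ k, (Real.log (facetDist ν b k z) + 1) • ν k + fderivWithin ℝ v P z := by
    intro z hz
    have hzP := mem_interior_iff_mem_nhds.1 hz
    have hvd := (hv.differentiableOn (by simp) z
      (interior_subset hz)).hasFDerivWithinAt.hasFDerivAt hzP
    have hsum : HasFDerivAt (fun z => ∑ k, facetDist ν b k z * Real.log (facetDist ν b k z))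
        (∑ k, (Real.log (facetDist ν b k z) + 1) • ν k) z :=
      HasFDerivAt.fun_sum fun k _ =>
        (Real.hasDerivAt_mul_log (hpos z hz k)).comp_hasFDerivAt z (hasFDerivAt_facetDist k z)
    refine HasFDerivAt.fderiv ((hsum.add hvd).congr_of_eventuallyEq ?_)
    filter_upwards [hzP] with x hx using hu x hx
  ext i j
  have h2 : (fun z => fderiv ℝ u z (e j)) =ᶠ[𝓝 y] fun z =>
      ∑ k, (Real.log (facetDist ν b k z) + 1) * ν k (e j) + fderivWithin ℝ v P z (e j) := by
    filter_upwards [isOpen_interior.mem_nhds hy] with z hz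
    simp [h1 z hz]
  rw [hessian, h2.fderiv_eq]
  have hvd := ((hasFDerivWithinAt_fderivWithin hs hv (interior_subset hy)).hasFDerivAt
    (mem_interior_iff_mem_nhds.1 hy)).clm_apply (hasFDerivAt_const (e j) y)
  have hsum : HasFDerivAt (fun z => ∑ k, (Real.log (facetDist ν b k z) + 1) * ν k (e j))
      (∑ k, ν k (e j) • (facetDist ν b k y)⁻¹ • ν k) y :=
    HasFDerivAt.fun_sum fun k _ =>
      (((hasFDerivAt_facetDist k y).log (hpos y hy k)).add_const 1).mul_const (ν k (e j))
  rw [(hsum.fun_add hvd).fderiv]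
  simp only [add_apply, sum_apply, smul_apply, smul_eq_mul, Matrix.of_apply]
  rw [add_comm]
  congr 1
  · simp
  · exact Finset.sum_congr rfl fun k _ => by ring

end Hessian

end Toric

theorem mainTheorem8 {V : Type*} [NormedAddCommGroup V] [NormedSpace ℝ V] [FiniteDimensional ℝ V]
    (M : Submodule ℤ V) [DiscreteTopology M] [IsZLattice ℝ M]
    {ι : Type*} [Fintype ι] (ν : ι → V →L[ℝ] ℝ) (b : ι → ℝ) (hP : Toric.IsDelzant M ν b)
    (u : V → ℝ) (hu : Toric.IsSymplecticPotential ν b u)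
    {n : ℕ} (e : Module.Basis (Fin n) ℝ V) :
    ∃ G : V → Matrix (Fin n) (Fin n) ℝ,
      -- the entries are smooth on the closed polytope
      (∀ i j, ContDiffOn ℝ ∞ (fun y => G y i j) (Toric.polytope ν b)) ∧
      -- in the interior, `G` is the inverse of the Hessian of `u`
      (∀ y ∈ interior (Toric.polytope ν b),
        Toric.hessian e u y * G y = 1 ∧ G y * Toric.hessian e u y = 1) ∧
      ∀ I : Set ι, ∀ y ∈ Toric.openFace ν b I,
        -- on every face `G` is positive semidefinite
        (G y).PosSemidef ∧
        -- it is positive definite on the tangent space of the face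
        (∀ w ∈ Toric.faceTangent ν I, w ≠ 0 →
          0 < ∑ i, ∑ j, G y i j * e.repr w i * e.repr w j) ∧
        -- the same without coordinates: `G` is a tensor on the tangent space of the face, and
        -- it is positive definite as such
        (∀ ξ : V →L[ℝ] ℝ, Toric.contract e (G y) ξ ∈ Toric.faceTangent ν I) ∧
        (∀ ξ : V →L[ℝ] ℝ, (∃ w ∈ Toric.faceTangent ν I, ξ w ≠ 0) →
          0 < ξ (Toric.contract e (G y) ξ)) := by
  classical
  obtain ⟨v, hv, huv⟩ := hu.guillemin
  set P := Toric.polytope ν b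
  have hs : UniqueDiffOn ℝ P := hP.uniqueDiffOn
  have hB : ∀ y ∈ P, Toric.PosOnFace (Toric.hessWithin v P y) ν
      fun k => Toric.facetDist ν b k y := fun y hy w hw hw0 => by
    rw [← Toric.iteratedDeriv_two_line hs hv huv hy hw]
    -- The face is the one whose relative interior contains `y`.
    exact hu.hessian_face {k | Toric.facetDist ν b k y = 0} y ⟨hy, fun _ => Iff.rfl⟩ w hw hw0
  let K : V → Matrix (Fin n ⊕ ι) (Fin n ⊕ ι) ℝ := fun y =>
    Toric.bordered e (Toric.hessWithin v P y) ν fun k => Toric.facetDist ν b k y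
  have hK : ∀ y ∈ P, IsUnit (K y).det := fun y hy =>
    Toric.isUnit_det_bordered (hB y hy) (hP.linearIndependent hy)
  have hsmooth : ∀ p q, ContDiffOn ℝ ∞ (fun y => K y p q) P := by
    have hH := Toric.contDiffOn_hessWithin hs hv
    rintro (i | k) (j | l)
    · exact (hH.clm_apply contDiffOn_const).clm_apply contDiffOn_const
    · exact contDiffOn_const
    · exact contDiffOn_const
    · by_cases hkl : k = l
      · subst hkl
        simpa [K, Toric.bordered] using (Toric.contDiff_facetDist (ν := ν) k).neg.contDiffOn
      · simpa [K, Toric.bordered, hkl] using contDiffOn_const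
  refine ⟨fun y => (K y)⁻¹.toBlocks₁₁, fun i j =>
    Toric.contDiffOn_matrix_inv hsmooth hK (Sum.inl i) (Sum.inl j), fun y hy => ?_,
    fun I y hy => ?_⟩
  · have hν : ∀ i, ν i ≠ 0 := fun i => (hP.prime i).ne_zero
    have h : Toric.hessian e u y * (K y)⁻¹.toBlocks₁₁ = 1 := by
      rw [Toric.hessian_eq_of_mem_interior hs hv hν huv e hy]
      exact Toric.mul_inv_bordered
        (fun k => (Toric.facetDist_pos_of_mem_interior (hν k) hy).ne') (hK y (interior_subset hy))
    exact ⟨h, mul_eq_one_comm.1 h⟩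
  · obtain ⟨hyP, hyI⟩ := hy
    have hpos := fun a w (hw : w ∈ Toric.faceTangent ν I) => Toric.dotProduct_inv_bordered_pos (e := e) (hB y hyP) (hK y hyP)
      (a := a) (w := w) (fun k hk => hw k ((hyI k).1 hk))
    have hcontract : ∀ ξ : V →L[ℝ] ℝ, Toric.contract e (K y)⁻¹.toBlocks₁₁ ξ =
        e.equivFun.symm ((K y)⁻¹.toBlocks₁₁.mulVec fun j => ξ (e j)) := fun ξ => by
      simp [Toric.contract, Module.Basis.equivFun_symm_apply, Matrix.mulVec, dotProduct]
    have hpair : ∀ (ξ : V →L[ℝ] ℝ) (w : Fin n → ℝ),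
        ξ (e.equivFun.symm w) = (fun j => ξ (e j)) ⬝ᵥ w := fun ξ w => by
      simp [Module.Basis.equivFun_symm_apply, dotProduct, mul_comm]
    refine ⟨Toric.posSemidef_inv_bordered (fun w w' => ?_) (hB y hyP) (hK y hyP),
      fun w hw hw0 => ?_, fun ξ k hk => ?_, fun ξ ⟨w, hw, hξw⟩ => ?_⟩
    · exact Toric.hessWithin_comm hP.interior_nonempty hv hyP w w'
    -- The covector with the same coordinates as `w` takes the value `∑ (w^i)² ≠ 0` on `w`, so it
    -- does not vanish on the tangent space.
    · have := hpos (e.equivFun w) w hw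
        (by rw [Ne, dotProduct_self_eq_zero]; simpa using hw0)
      convert this using 1
      simp only [dotProduct, Matrix.mulVec, Finset.mul_sum, Module.Basis.equivFun_apply]
      exact Finset.sum_congr rfl fun _ _ => Finset.sum_congr rfl fun _ _ => by ring
    · rw [hcontract]
      exact Toric.apply_inv_bordered (hK y hyP) _ ((hyI k).2 hk)
    · rw [hcontract, hpair]
      refine hpos _ w hw ?_
      rwa [← hpair, LinearEquiv.symm_apply_apply]
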